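/- Let $\alpha>0$ and let $\mu$ be a nonzero, finite, non-atomic measure on a measurable space $\Omega$, with $\gamma=\mu(\Omega)$. Let $$C_i\sim\mathrm{Poisson}(\gamma),\qquad V_{ij}^{(l)}\sim\mathrm{Beta}(1,\alpha)\ (1\le l\le i),\qquad \theta_{ij}\sim\mu/\gamma\qquad(i,j\ge 1)$$ be mutually independent random variables, and set $$\pi_{ij}=V_{ij}^{(i)}\prod_{l=1}^{i-1}\bigl(1-V_{ij}^{(l)}\bigr),\qquad H=\sum_{i=1}^{\infty}\sum_{j=1}^{C_i}\pi_{ij}\,\delta_{\theta_{ij}} .$$ Then $H$ is a beta process $\mathrm{BP}(\alpha,\mu)$, that is, a random measure which is almost surely of the form $\sum_{(\theta,\pi)\in\Pi}\pi\,\delta_\theta$ for a Poisson process $\Pi$ on $\Omega\times[0,1]$ with mean measure $$\nu(d\theta,d\pi)=\alpha\,\pi^{-1}(1-\pi)^{\alpha-1}\,d\pi\,\mu(d\theta).$$ More precisely, one can take $\Pi=\{(\theta_{ij},\pi_{ij}) : i\ge 1,\ 1\le j\le C_i\}$. Here a random countable set $\Pi$ is called a Poisson process with mean measure $\nu$ if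 the number $N(A)$ of points of $\Pi$ in $A$ is $\mathrm{Poisson}(\nu(A))$-distributed for every measurable $A$ (with $N(A)=\infty$ almost surely if $\nu(A)=\infty$), and $N(A_1),\dots,N(A_n)$ are independent for pairwise disjoint measurable $A_1,\dots,A_n$. -/

import Mathlib

open MeasureTheory ProbabilityTheory
open scoped ENNReal NNReal

noncomputable section

/-- The Poisson distribution with parameter `r ∈ [0, ∞]`, as a law on `ℕ ∪ {∞}`; the Poisson
distribution with infinite parameter is the point mass at `∞`. -/
def extPoisson (r : ℝ≥0∞) : Measure ℕ∞ :=
  if r = ∞ then Measure.dirac ⊤ else (poissonMeasure r.toNNReal).map (fun n : ℕ => (n : ℕ∞))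

/-- A random countable subset `Π` of `X`, defined on the probability space `(S, P)`, is a Poisson
process with mean measure `ν` if the number `N(A)` of its points in a measurable set `A` has the
Poisson distribution with parameter `ν A`, and `N(A₁), …, N(Aₙ)` are independent whenever
`A₁, …, Aₙ` are pairwise disjoint measurable sets. -/
structure IsPoissonProcess {S X : Type*} [MeasurableSpace S] [MeasurableSpace X]
    (P : Measure S) (Pt : S → Set X) (ν : Measure X) : Prop where
  countable : ∀ᵐ s ∂P, (Pt s).Countable
  hasLaw_count : ∀ A : Set X, MeasurableSet A →
    HasLaw (fun s => (Pt s ∩ A).encard) (extPoisson (ν A)) P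
  indep_count : ∀ (n : ℕ) (A : Fin n → Set X), (∀ k, MeasurableSet (A k)) →
    Pairwise (fun k l => Disjoint (A k) (A l)) →
      iIndepFun (fun k s => (Pt s ∩ A k).encard) P

/-- The Lévy measure `λ(dπ) = α π⁻¹ (1 - π) ^ (α - 1) dπ` on `[0, 1]`. -/
def betaLevyMeasure (α : ℝ) : Measure ℝ :=
  (volume.restrict (Set.Icc 0 1)).withDensity
    (fun x => ENNReal.ofReal (α * x⁻¹ * (1 - x) ^ (α - 1)))

/-- The measure `ν(dθ, dπ) = α π⁻¹ (1 - π) ^ (α - 1) dπ μ(dθ)`. -/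
def betaMeanMeasure {Θ : Type*} [MeasurableSpace Θ] (α : ℝ) (μ : Measure Θ) : Measure (Θ × ℝ) :=
  μ.prod (betaLevyMeasure α)

/-- The measure `∑_{(θ, π) ∈ E} π δ_θ` attached to a set `E` of weighted locations. -/
def weightedAtoms {Θ : Type*} [MeasurableSpace Θ] (E : Set (Θ × ℝ)) : Measure Θ :=
  Measure.sum (fun p : E => ENNReal.ofReal p.1.2 • Measure.dirac p.1.1)

/-- The random measure `H` on `Θ`, defined on the probability space `(S, P)`, has the underlying
random point set `Π ⊆ Θ × [0, 1]`, and this is a Poisson process with mean measure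
`α π⁻¹ (1 - π) ^ (α - 1) dπ μ(dθ)`. -/
structure HasUnderlyingBetaPoisson {S Θ : Type*} [MeasurableSpace S] [MeasurableSpace Θ]
    (α : ℝ) (μ : Measure Θ) (P : Measure S) (H : S → Measure Θ) (Pt : S → Set (Θ × ℝ)) :
    Prop where
  weights_mem : ∀ᵐ s ∂P, ∀ p ∈ Pt s, p.2 ∈ Set.Icc (0 : ℝ) 1
  poisson : IsPoissonProcess P Pt (betaMeanMeasure α μ)
  eq_weightedAtoms : ∀ᵐ s ∂P, H s = weightedAtoms (Pt s)

/-- `H ∼ BP(α, μ)`: the random measure `H` is a beta process with concentration parameter `α` and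
(non-atomic, finite) base measure `μ`. -/
structure IsBetaProcess {S Θ : Type*} [MeasurableSpace S] [MeasurableSpace Θ]
    (α : ℝ) (μ : Measure Θ) (P : Measure S) (H : S → Measure Θ) : Prop where
  aemeasurable : AEMeasurable H P
  exists_underlying : ∃ Pt : S → Set (Θ × ℝ), HasUnderlyingBetaPoisson α μ P H Pt

/-- Indices of the random variables of the stick-breaking construction. Rounds `i`, atoms `j`
and breaks `l` are counted from `0`; an atom of round `i` uses the breaks `0, …, i`. -/
inductive StickIndex : Type
  | count (i : ℕ) : StickIndex
  | stick (i j : ℕ) (l : Fin (i + 1)) : StickIndex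
  | location (i j : ℕ) : StickIndex

/-- The σ-algebra generated by the random variable with the given index. -/
abbrev stickSigma {S Θ : Type*} [MeasurableSpace Θ]
    (C : ℕ → S → ℕ) (V : (i j : ℕ) → Fin (i + 1) → S → ℝ) (θ : ℕ → ℕ → S → Θ) :
    StickIndex → MeasurableSpace S
  | .count i => MeasurableSpace.comap (C i) inferInstance
  | .stick i j l => MeasurableSpace.comap (V i j l) inferInstance
  | .location i j => MeasurableSpace.comap (θ i j) inferInstance

/-- The random variables of the stick-breaking construction: `C i ∼ Poisson(μ(Θ))`,
`V i j l ∼ Beta(1, α)`, `θ i j ∼ μ / μ(Θ)`, all of them mutually independent. -/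
structure IsStickBreakingFamily {S Θ : Type*} [MeasurableSpace S] [MeasurableSpace Θ]
    (α : ℝ) (μ : Measure Θ) (P : Measure S)
    (C : ℕ → S → ℕ) (V : (i j : ℕ) → Fin (i + 1) → S → ℝ) (θ : ℕ → ℕ → S → Θ) : Prop where
  measurable_count : ∀ i, Measurable (C i)
  measurable_stick : ∀ i j l, Measurable (V i j l)
  measurable_location : ∀ i j, Measurable (θ i j)
  law_count : ∀ i, HasLaw (C i) (poissonMeasure (μ Set.univ).toNNReal) P
  law_stick : ∀ i j l, HasLaw (V i j l) (betaMeasure 1 α) P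
  law_location : ∀ i j, HasLaw (θ i j) ((μ Set.univ)⁻¹ • μ) P
  indep : iIndep (stickSigma C V θ) P

/-- The weight of atom `j` of round `i`: the last break `V i j i` of its stick times the product
of `1 - V i j l` over the earlier breaks `l < i`. -/
def stickWeight {S : Type*} (V : (i j : ℕ) → Fin (i + 1) → S → ℝ) (i j : ℕ) (s : S) : ℝ :=
  V i j (Fin.last i) s * ∏ l : Fin i, (1 - V i j l.castSucc s)

/-- The stick-breaking random measure: the sum over all rounds `i` and all atoms `j < C i` of
`stickWeight V i j` times the point mass at `θ i j`. -/
def stickBreakingMeasure {S Θ : Type*} [MeasurableSpace Θ]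
    (C : ℕ → S → ℕ) (V : (i j : ℕ) → Fin (i + 1) → S → ℝ) (θ : ℕ → ℕ → S → Θ) (s : S) :
    Measure Θ :=
  Measure.sum (fun i : ℕ => ∑ j ∈ Finset.range (C i s),
    ENNReal.ofReal (stickWeight V i j s) • Measure.dirac (θ i j s))

/-- The random set of all pairs (location, weight) of the stick-breaking construction. -/
def stickBreakingPoints {S Θ : Type*}
    (C : ℕ → S → ℕ) (V : (i j : ℕ) → Fin (i + 1) → S → ℝ) (θ : ℕ → ℕ → S → Θ) (s : S) :
    Set (Θ × ℝ) :=
  {p | ∃ i j : ℕ, j < C i s ∧ p = (θ i j s, stickWeight V i j s)}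

end

/-! Write `γ = μ(Ω)` and let `λᵢ` be the law of a weight of round `i`. A round consists of a
Poisson(`γ`) number of independent points with law `(μ/γ) ⊗ λᵢ`. Its characteristic functional on
step functions (`integral_exp_markCount`) shows that its counts in disjoint sets are independent
Poisson variables with means given by `μ ⊗ λᵢ`. The rounds are independent, so their counts add up
to Poisson counts with mean measure `μ ⊗ ∑ λᵢ`, the value `∞` included
(`hasLaw_iSup_sum_range_poisson`). The weights have atomless laws and are independent, so almost
surely no two points coincide and a sum over indices is a sum over the random set.

It remains to see that `∑ λᵢ` is the Lévy measure `λ` (`betaLevyMeasure_eq_sum`). Let `T` be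
multiplicative convolution with the law of `1 - V`, so that `λ₀ = Beta(1, α)` and `λᵢ₊₁ = T λᵢ`. The
core is the fixed point equation `λ = λ₀ + T λ` (`betaLevyMeasure_eq_add`): `T λ` has density `α (1
- x)^α / x`, and `x + (1 - x) = 1`. Iterating gives `λ = λ₀ + ⋯ + λₙ₋₁ + Tⁿ λ`. The first moment of
`Tⁿ λ` is `(E[1 - V])ⁿ`, which tends to `0`, so by Markov's inequality the remainder disappears on
every `[ε, ∞)`. -/

open MeasureTheory ProbabilityTheory
open scoped ENNReal NNReal

/-! ### Independence of disjoint blocks -/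

section Grouping

/-- Random variables that depend on disjoint blocks of a family of independent σ-algebras are
independent. -/
lemma iIndepFun_of_measurable_iSup {S ι κ : Type*} {mS : MeasurableSpace S} {P : Measure S}
    {m : ι → MeasurableSpace S} (hm : ∀ i, m i ≤ mS) (h : iIndep m P)
    {T : κ → Set ι} (hT : Pairwise fun k l => Disjoint (T k) (T l))
    {β : κ → Type*} [∀ k, MeasurableSpace (β k)] {X : ∀ k, S → β k}
    (hX : ∀ k, Measurable[⨆ i ∈ T k, m i] (X k)) : iIndepFun X P := by
  classical
  have := h.isProbabilityMeasure
  rw [iIndepFun_iff_measure_inter_preimage_eq_mul]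
  intro s
  induction s using Finset.induction_on with
  | empty => simp
  | insert a s ha ih =>
    intro A hA
    rw [Finset.set_biInter_insert, Finset.prod_insert ha,
      ← ih fun i hi => hA i (Finset.mem_insert_of_mem hi)]
    have hdisj : Disjoint (T a) (⋃ k ∈ s, T k) := by
      rw [Set.disjoint_iUnion₂_right]
      exact fun k hk => hT fun hak => ha (hak ▸ hk)
    -- Block `a` is independent of the union of the other blocks, and the intersection of the
    -- remaining events is measurable for that union.
    have hind := (Indep_iff _ _ _).1 (indep_iSup_of_disjoint hm h hdisj)
    refine hind _ _ (hX a (hA a (Finset.mem_insert_self _ _))) ?_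
    refine Finset.measurableSet_biInter _ fun k hk => ?_
    have hle : (⨆ i ∈ T k, m i) ≤ ⨆ i ∈ ⋃ k ∈ s, T k, m i :=
      biSup_mono fun i hi => Set.mem_biUnion hk hi
    exact hle _ (hX k (hA k (Finset.mem_insert_of_mem hk)))

end Grouping

/-! ### One round: a Poisson number of independent points -/

section PoissonMarking

variable {S E : Type*} [MeasurableSpace S] [MeasurableSpace E] {P : Measure S}

/-- The probability generating function of the Poisson distribution. -/
lemma integral_pow_poissonMeasure (r : ℝ≥0) (w : ℂ) :
    ∫ n, w ^ n ∂(poissonMeasure r) = Complex.exp (r * (w - 1)) := by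
  rw [integral_poissonMeasure]
  have h1 : ∀ n : ℕ, (Real.exp (-r) * r ^ n / n.factorial : ℝ) • w ^ n
      = (Real.exp (-r) : ℂ) * ((r * w) ^ n / n.factorial) := by
    intro n
    rw [Complex.real_smul]
    push_cast
    ring
  simp_rw [h1]
  rw [tsum_mul_left, (NormedSpace.expSeries_div_hasSum_exp ((r : ℂ) * w)).tsum_eq,
    ← Complex.exp_eq_exp_ℂ, Complex.ofReal_exp, ← Complex.exp_add]
  push_cast
  ring_nf

/-- The characteristic functional of a Poisson number of independent identically distributed
points. -/
lemma integral_prod_range_poisson [IsProbabilityMeasure P] {C : S → ℕ} {r : ℝ≥0}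
    {X : ℕ → S → E} {ρ : Measure E} (hC : HasLaw C (poissonMeasure r) P)
    (hXm : ∀ j, Measurable (X j)) (hXl : ∀ j, HasLaw (X j) ρ P) (hX : iIndepFun X P)
    (hCX : IndepFun C (fun s j => X j s) P) {φ : E → ℂ} (hφ : Measurable φ)
    (hφ1 : ∀ x, ‖φ x‖ ≤ 1) :
    ∫ s, ∏ j ∈ Finset.range (C s), φ (X j s) ∂P = Complex.exp (r * (∫ x, φ x ∂ρ - 1)) := by
  have hXm' : Measurable fun s j => X j s := measurable_pi_iff.2 hXm
  have hlaw : P.map (fun s => (C s, fun j => X j s))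
      = (poissonMeasure r).prod (P.map fun s j => X j s) := by
    rw [(indepFun_iff_map_prod_eq_prod_map_map hC.aemeasurable hXm'.aemeasurable).1 hCX, hC.map_eq]
  have : IsProbabilityMeasure (P.map fun s j => X j s) :=
    Measure.isProbabilityMeasure_map hXm'.aemeasurable
  set F : ℕ × (ℕ → E) → ℂ := fun p => ∏ j ∈ Finset.range p.1, φ (p.2 j) with hF
  have hFm : Measurable F := measurable_from_prod_countable_right fun n => by
    simp only [hF]
    fun_prop
  have hFb : ∀ p, ‖F p‖ ≤ 1 := fun p => by
    simp only [hF, norm_prod]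
    exact Finset.prod_le_one (fun _ _ => norm_nonneg _) fun _ _ => hφ1 _
  have hFi : Integrable F ((poissonMeasure r).prod (P.map fun s j => X j s)) :=
    Integrable.of_bound hFm.aestronglyMeasurable 1 (Filter.Eventually.of_forall hFb)
  calc ∫ s, ∏ j ∈ Finset.range (C s), φ (X j s) ∂P
      = ∫ p, F p ∂(P.map (fun s => (C s, fun j => X j s))) := by
        rw [integral_map (hC.aemeasurable.prodMk hXm'.aemeasurable) hFm.aestronglyMeasurable]
    -- Freezing `C = n`, which the product law permits, leaves `n` independent factors with the same
    -- mean; the generating function is then taken at that mean.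
    _ = ∫ n, (∫ x, φ x ∂ρ) ^ n ∂(poissonMeasure r) := by
        rw [hlaw, integral_prod _ hFi]
        refine integral_congr_ae (Filter.Eventually.of_forall fun n => ?_)
        simp only [hF]
        have hm : Measurable fun x : ℕ → E => ∏ j ∈ Finset.range n, φ (x j) := by fun_prop
        rw [integral_map hXm'.aemeasurable hm.aestronglyMeasurable]
        have h1 : iIndepFun (fun (j : Fin n) s => φ (X j s)) P :=
          (hX.comp (fun _ => φ) fun _ => hφ).precomp Fin.val_injective
        have h2 := h1.integral_fun_prod_eq_prod_integral
          fun j => (hφ.comp (hXm j)).aestronglyMeasurable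
        simp_rw [Finset.prod_range, h2]
        have h3 : ∀ j : Fin n, ∫ s, φ (X j s) ∂P = ∫ x, φ x ∂ρ :=
          fun j => (hXl j).integral_comp hφ.aestronglyMeasurable
        simp [h3]
    _ = _ := integral_pow_poissonMeasure r _

/-- The number of indices `j < c` with `x j ∈ A`. -/
noncomputable def markCount (A : Set E) (c : ℕ) (x : ℕ → E) : ℕ :=
  ∑ j ∈ Finset.range c, A.indicator 1 (x j)

lemma measurable_markCount {A : Set E} (hA : MeasurableSet A) {C : S → ℕ} {X : ℕ → S → E}
    (hC : Measurable C) (hX : ∀ j, Measurable (X j)) :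
    Measurable fun s => markCount A (C s) fun j => X j s := by
  have h : Measurable fun p : ℕ × (ℕ → E) => markCount A p.1 p.2 :=
    measurable_from_prod_countable_right fun n => by
      simp only [markCount]
      exact Finset.measurable_sum _ fun j _ =>
        (measurable_one.indicator hA).comp (measurable_pi_apply j)
  exact h.comp (hC.prodMk (measurable_pi_iff.2 hX))

/-- The joint characteristic function of the numbers of points in disjoint sets, for a Poisson
number of independent identically distributed points. -/
lemma integral_exp_markCount [IsProbabilityMeasure P] {C : S → ℕ} {r : ℝ≥0}
    {X : ℕ → S → E} {ρ : Measure E} (hC : HasLaw C (poissonMeasure r) P)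
    (hXm : ∀ j, Measurable (X j)) (hXl : ∀ j, HasLaw (X j) ρ P) (hX : iIndepFun X P)
    (hCX : IndepFun C (fun s j => X j s) P) {κ : Type*} [Fintype κ] {A : κ → Set E}
    (hA : ∀ k, MeasurableSet (A k)) (hdisj : Pairwise fun k l => Disjoint (A k) (A l))
    (t : κ → ℝ) :
    ∫ s, Complex.exp ((∑ k, (markCount (A k) (C s) fun j => X j s : ℝ) * t k : ℝ) * Complex.I) ∂P
      = ∏ k, Complex.exp ((r * (ρ (A k)).toNNReal : ℝ≥0) *
          (Complex.exp (t k * Complex.I) - 1)) := by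
  classical
  have : IsProbabilityMeasure ρ := (hXl 0).isProbabilityMeasure_iff.1 inferInstance
  -- Summing `ψ` over the points gives `∑ t k * N(A k)`. By disjointness at most one indicator is
  -- nonzero at each point, so `exp (iψ) - 1` is linear in the indicators and the exponent splits
  -- over `k`.
  set ψ : E → ℝ := fun x => ∑ k, (A k).indicator (fun _ => t k) x with hψ
  have hψm : Measurable ψ :=
    Finset.measurable_sum _ fun k _ => measurable_const.indicator (hA k)
  set φ : E → ℂ := fun x => Complex.exp (ψ x * Complex.I) with hφ
  have hφm : Measurable φ := by fun_prop
  have hφ1 : ∀ x, ‖φ x‖ ≤ 1 := fun x => (Complex.norm_exp_ofReal_mul_I _).le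
  have hφe : ∀ x,
      φ x = 1 + ∑ k, (A k).indicator (fun _ => Complex.exp (t k * Complex.I) - 1) x := by
    intro x
    by_cases hx : ∃ k, x ∈ A k
    · obtain ⟨k, hk⟩ := hx
      have hne : ∀ l, l ≠ k → x ∉ A l := fun l hl hxl =>
        Set.disjoint_left.1 (hdisj hl) hxl hk
      simp only [hφ, hψ]
      rw [Finset.sum_eq_single k (fun l _ hl => Set.indicator_of_notMem (hne l hl) _) (by simp),
        Finset.sum_eq_single k (fun l _ hl => Set.indicator_of_notMem (hne l hl) _) (by simp),
        Set.indicator_of_mem hk, Set.indicator_of_mem hk]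
      ring
    · push Not at hx
      simp [hφ, hψ, hx]
  have hint : ∫ x, φ x ∂ρ - 1
      = ∑ k, ((ρ (A k)).toNNReal : ℂ) * (Complex.exp (t k * Complex.I) - 1) := by
    have hi : ∀ k, Integrable
        ((A k).indicator fun _ => Complex.exp (t k * Complex.I) - 1) ρ := fun k =>
      (integrable_const _).indicator (hA k)
    simp_rw [hφe]
    rw [integral_add (integrable_const _) (integrable_finsetSum _ fun k _ => hi k),
      integral_finsetSum _ fun k _ => hi k]
    simp only [integral_const, probReal_univ, one_smul, add_sub_cancel_left]
    refine Finset.sum_congr rfl fun k _ => ?_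
    rw [integral_indicator_const _ (hA k), Complex.real_smul]
    rfl
  rw [← Complex.exp_sum]
  have hmain := integral_prod_range_poisson hC hXm hXl hX hCX hφm hφ1
  rw [hint, Finset.mul_sum] at hmain
  convert hmain using 2
  · ext s
    simp only [hφ, hψ, markCount]
    rw [← Complex.exp_sum, ← Finset.sum_mul, ← Complex.ofReal_sum, Finset.sum_comm]
    congr 3
    refine Finset.sum_congr rfl fun k _ => ?_
    push_cast
    rw [Finset.sum_mul]
    refine Finset.sum_congr rfl fun j _ => ?_
    by_cases h : X j s ∈ A k <;> simp [h]
  · refine Finset.sum_congr rfl fun k _ => ?_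
    push_cast
    ring

/-- The joint formula for a single set is the Poisson characteristic function, which determines the
law after the embedding of `ℕ` in `ℝ`. -/
lemma hasLaw_markCount [IsProbabilityMeasure P] {C : S → ℕ} {r : ℝ≥0}
    {X : ℕ → S → E} {ρ : Measure E} (hCm : Measurable C) (hC : HasLaw C (poissonMeasure r) P)
    (hXm : ∀ j, Measurable (X j)) (hXl : ∀ j, HasLaw (X j) ρ P) (hX : iIndepFun X P)
    (hCX : IndepFun C (fun s j => X j s) P) {A : Set E} (hA : MeasurableSet A) :
    HasLaw (fun s => markCount A (C s) fun j => X j s)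
      (poissonMeasure (r * (ρ A).toNNReal)) P := by
  have hm := measurable_markCount hA hCm hXm
  refine ⟨hm.aemeasurable, (MeasurableEmbedding.natCast (α := ℝ)).map_injective ?_⟩
  have : IsProbabilityMeasure (P.map fun s => markCount A (C s) fun j => X j s) :=
    Measure.isProbabilityMeasure_map hm.aemeasurable
  have : IsProbabilityMeasure
      ((P.map fun s => markCount A (C s) fun j => X j s).map (Nat.cast : ℕ → ℝ)) :=
    Measure.isProbabilityMeasure_map (by fun_prop)
  refine Measure.ext_of_charFun (funext fun t => ?_)
  rw [charFun_map_cast_poissonMeasure, charFun_apply, integral_map (by fun_prop) (by fun_prop),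
    integral_map hm.aemeasurable (by fun_prop)]
  have h := integral_exp_markCount hC hXm hXl hX hCX (κ := Unit) (A := fun _ => A)
    (fun _ => hA) (fun k l hkl => (hkl rfl).elim) (fun _ => t)
  simpa [mul_comm] using h

/-- The numbers of points in disjoint sets are independent, for a Poisson number of independent
identically distributed points. -/
lemma iIndepFun_markCount [IsProbabilityMeasure P] {C : S → ℕ} {r : ℝ≥0}
    {X : ℕ → S → E} {ρ : Measure E} (hCm : Measurable C) (hC : HasLaw C (poissonMeasure r) P)
    (hXm : ∀ j, Measurable (X j)) (hXl : ∀ j, HasLaw (X j) ρ P) (hX : iIndepFun X P)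
    (hCX : IndepFun C (fun s j => X j s) P) {κ : Type*} [Fintype κ] {A : κ → Set E}
    (hA : ∀ k, MeasurableSet (A k)) (hdisj : Pairwise fun k l => Disjoint (A k) (A l)) :
    iIndepFun (fun k s => markCount (A k) (C s) fun j => X j s) P := by
  have hm := fun k => measurable_markCount (hA k) hCm hXm
  have hreal : iIndepFun (fun k s => (markCount (A k) (C s) fun j => X j s : ℝ)) P := by
    have hm' : ∀ k, Measurable fun s => (markCount (A k) (C s) fun j => X j s : ℝ) :=
      fun k => measurable_from_nat.comp (hm k)
    rw [iIndepFun_iff_charFun_pi fun k => (hm' k).aemeasurable]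
    intro t
    have h := integral_exp_markCount hC hXm hXl hX hCX hA hdisj (fun k => t k)
    have hmL : Measurable fun s =>
        WithLp.toLp 2 fun k => (markCount (A k) (C s) fun j => X j s : ℝ) :=
      (WithLp.measurable_toLp _ _).comp (measurable_pi_iff.2 hm')
    rw [charFun_apply, integral_map hmL.aemeasurable (by fun_prop)]
    have h1 : ∀ k, charFun (P.map fun s => (markCount (A k) (C s) fun j => X j s : ℝ)) (t k)
        = Complex.exp ((r * (ρ (A k)).toNNReal : ℝ≥0) *
          (Complex.exp (t k * Complex.I) - 1)) := by
      intro k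
      rw [← charFun_map_cast_poissonMeasure,
        ← (hasLaw_markCount hCm hC hXm hXl hX hCX (hA k)).map_eq,
        Measure.map_map (by fun_prop) (hm k)]
      rfl
    simp_rw [h1]
    rw [← h]
    simp [PiLp.inner_apply, mul_comm]
  -- The floor recovers the integer counts from their real casts.
  have := hreal.comp (fun _ x => ⌊x⌋₊) fun _ => Nat.measurable_floor
  simpa [Function.comp_def] using this

end PoissonMarking

/-! ### Sums of independent Poisson variables, possibly infinite -/

section PoissonSuperposition

variable {S : Type*} [MeasurableSpace S] {P : Measure S}

lemma hasLaw_sum_range_poisson [IsProbabilityMeasure P] {Y : ℕ → S → ℕ} {r : ℕ → ℝ≥0}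
    (hYm : ∀ i, Measurable (Y i)) (hYl : ∀ i, HasLaw (Y i) (poissonMeasure (r i)) P)
    (hY : iIndepFun Y P) (n : ℕ) :
    HasLaw (fun s => ∑ i ∈ Finset.range n, Y i s)
      (poissonMeasure (∑ i ∈ Finset.range n, r i)) P := by
  induction n with
  | zero =>
    have h0 : poissonMeasure 0 = Measure.dirac 0 := by
      refine Measure.ext_of_singleton fun n => ?_
      rw [poissonMeasure_singleton]
      rcases eq_or_ne n 0 with rfl | hn
      · simp
      · simp [hn, hn.symm]
    simpa [h0] using hasLaw_dirac_of_ae_eq (P := P) (X := fun _ => 0) (x := 0) (by rfl)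
  | succ n ih =>
    simp_rw [Finset.sum_range_succ]
    have hind : IndepFun (∑ i ∈ Finset.range n, Y i) (Y n) P :=
      hY.indepFun_finsetSum_of_notMem hYm (by simp)
    rw [Finset.sum_fn] at hind
    exact IndepFun.hasLaw_add_poissonMeasure hind ih (hYl n)

lemma extPoisson_Iic_of_ne_top {r : ℝ≥0} (m : ℕ) :
    extPoisson r (Set.Iic (m : ℕ∞))
      = ∑ k ∈ Finset.range (m + 1), ENNReal.ofReal (Real.exp (-r) * r ^ k / k.factorial) := by
  have h1 : (fun n : ℕ => (n : ℕ∞)) ⁻¹' Set.Iic (m : ℕ∞) = (Finset.range (m + 1) : Set ℕ) := by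
    ext n; simp
  rw [extPoisson, if_neg ENNReal.coe_ne_top, Measure.map_apply (by fun_prop) .of_discrete, h1,
    ← sum_measure_singleton]
  simp [poissonMeasure_singleton]

/-- The Poisson distribution function is continuous in its parameter, also at `∞`: there `exp (-r) *
r ^ k` tends to `0`, in agreement with the point mass at `⊤`. -/
lemma tendsto_extPoisson_Iic (r : ℕ → ℝ≥0) (m : ℕ) :
    Filter.Tendsto
      (fun n => extPoisson (∑ i ∈ Finset.range n, r i : ℝ≥0) (Set.Iic (m : ℕ∞)))
      Filter.atTop (nhds (extPoisson (∑' i, (r i : ℝ≥0∞)) (Set.Iic (m : ℕ∞)))) := by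
  simp_rw [extPoisson_Iic_of_ne_top]
  by_cases h : ∑' i, (r i : ℝ≥0∞) = ∞
  · have hlim : Filter.Tendsto (fun n => ((∑ i ∈ Finset.range n, r i : ℝ≥0) : ℝ))
        Filter.atTop Filter.atTop := by
      have hs := ENNReal.tendsto_nat_tsum (fun i => (r i : ℝ≥0∞))
      rw [h] at hs
      rw [NNReal.tendsto_coe_atTop, ← ENNReal.tendsto_coe_nhds_top]
      simpa using hs
    have h0 : extPoisson (∑' i, (r i : ℝ≥0∞)) (Set.Iic (m : ℕ∞)) = 0 := by
      rw [extPoisson, if_pos h, Measure.dirac_apply]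
      simp
    rw [h0, ← Finset.sum_const_zero (s := Finset.range (m + 1))]
    refine tendsto_finsetSum _ fun k _ => ?_
    have h2 := ((Real.tendsto_pow_mul_exp_neg_atTop_nhds_zero k).div_const
      (k.factorial : ℝ)).comp hlim
    rw [zero_div] at h2
    have h3 := ENNReal.tendsto_ofReal h2
    rw [ENNReal.ofReal_zero] at h3
    refine h3.congr fun n => ?_
    simp only [Function.comp]
    rw [mul_comm]
  · obtain ⟨R, hR⟩ := WithTop.ne_top_iff_exists.1 h
    change (R : ℝ≥0∞) = _ at hR
    rw [← hR, extPoisson_Iic_of_ne_top]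
    have hlim : Filter.Tendsto (fun n => ((∑ i ∈ Finset.range n, r i : ℝ≥0) : ℝ))
        Filter.atTop (nhds (R : ℝ)) := by
      have hs := ENNReal.tendsto_nat_tsum (fun i => (r i : ℝ≥0∞))
      rw [← hR] at hs
      rw [NNReal.tendsto_coe, ← ENNReal.tendsto_coe]
      simpa using hs
    refine tendsto_finsetSum _ fun k _ => ENNReal.tendsto_ofReal ?_
    exact (((Real.continuous_exp.tendsto _).comp hlim.neg).mul (hlim.pow k)).div_const _

instance isProbabilityMeasure_extPoisson (r : ℝ≥0∞) : IsProbabilityMeasure (extPoisson r) := by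
  rw [extPoisson]
  split_ifs
  · infer_instance
  · exact Measure.isProbabilityMeasure_map (by fun_prop)

/-- This allows a law on `ℕ∞` to be identified by its values on the sets `Iic a`. Singletons are
closed and `ℕ∞` is countable, so every set is Borel. -/
instance borelSpace_enat : BorelSpace ℕ∞ := by
  refine ⟨le_antisymm (fun s _ => ?_) le_top⟩
  rw [← Set.biUnion_of_singleton s]
  exact @MeasurableSet.biUnion _ _ (borel ℕ∞) _ _ s.to_countable fun x _ => by
    borelize ℕ∞
    exact isClosed_singleton.measurableSet

/-- The sum of independent Poisson random variables has a Poisson distribution, possibly with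
infinite parameter. -/
lemma hasLaw_iSup_sum_range_poisson [IsProbabilityMeasure P] {Y : ℕ → S → ℕ} {r : ℕ → ℝ≥0}
    (hYm : ∀ i, Measurable (Y i)) (hYl : ∀ i, HasLaw (Y i) (poissonMeasure (r i)) P)
    (hY : iIndepFun Y P) :
    HasLaw (fun s => ⨆ n, ((∑ i ∈ Finset.range n, Y i s : ℕ) : ℕ∞))
      (extPoisson (∑' i, (r i : ℝ≥0∞))) P := by
  have hm : Measurable fun s => ⨆ n, ((∑ i ∈ Finset.range n, Y i s : ℕ) : ℕ∞) :=
    Measurable.iSup fun n => measurable_from_nat.comp (Finset.measurable_sum _ fun i _ => hYm i)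
  refine ⟨hm.aemeasurable, ?_⟩
  have : IsProbabilityMeasure
      (P.map fun s => ⨆ n, ((∑ i ∈ Finset.range n, Y i s : ℕ) : ℕ∞)) :=
    Measure.isProbabilityMeasure_map hm.aemeasurable
  refine Measure.ext_of_Iic _ _ fun a => ?_
  induction a using ENat.recTopCoe with
  | top => rw [Set.Iic_top, measure_univ, measure_univ]
  | coe m =>
  refine tendsto_nhds_unique ?_ (tendsto_extPoisson_Iic r m)
  -- The supremum is at most `m` exactly when all partial sums are; these events decrease, so
  -- continuity from above applies.
  have hset : (fun s => ⨆ n, ((∑ i ∈ Finset.range n, Y i s : ℕ) : ℕ∞)) ⁻¹' Set.Iic (m : ℕ∞)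
      = ⋂ n, {s | ∑ i ∈ Finset.range n, Y i s ≤ m} := by
    ext s
    simp only [Set.mem_preimage, Set.mem_Iic, iSup_le_iff, Nat.cast_le, Set.mem_iInter,
      Set.mem_ofPred_eq]
  have hms : ∀ n, MeasurableSet {s | ∑ i ∈ Finset.range n, Y i s ≤ m} := fun n =>
    measurableSet_le (Finset.measurable_sum _ fun i _ => hYm i) measurable_const
  rw [Measure.map_apply hm .of_discrete, hset]
  have hanti : Antitone fun n => {s | ∑ i ∈ Finset.range n, Y i s ≤ m} :=
    fun a b hab s (hs : _ ≤ m) =>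
      show _ ≤ m from (Finset.sum_le_sum_of_subset (Finset.range_mono hab)).trans hs
  refine (tendsto_measure_iInter_atTop (fun n => (hms n).nullMeasurableSet) hanti
    ⟨0, measure_ne_top _ _⟩).congr fun n => ?_
  rw [Function.comp_apply,
    (hasLaw_sum_range_poisson hYm hYl hY n).measure_eq (p := fun x => x ≤ m) .of_discrete,
    extPoisson, if_neg ENNReal.coe_ne_top, Measure.map_apply (by fun_prop) .of_discrete]
  congr 1
  ext x
  simp

end PoissonSuperposition

/-! ### The Lévy measure as the sum of the weight laws -/

section BetaLevy

open Set Filter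

variable {α : ℝ}

lemma betaMeasure_one_eq (hα : 0 < α) :
    betaMeasure 1 α = (volume.restrict (Ioo 0 1)).withDensity
      fun x => ENNReal.ofReal (α * (1 - x) ^ (α - 1)) := by
  have hb : 1 / beta 1 α = α := by
    rw [beta, Real.Gamma_one, add_comm 1 α, Real.Gamma_add_one hα.ne']
    have := (Real.Gamma_pos_of_pos hα).ne'
    field_simp
  rw [← withDensity_indicator measurableSet_Ioo, betaMeasure]
  congr 1
  ext x
  by_cases hx : x ∈ Ioo (0 : ℝ) 1
  · rw [indicator_of_mem hx, betaPDF_of_pos_lt_one hx.1 hx.2, hb]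
    simp
  · rw [indicator_of_notMem hx, betaPDF_eq, if_neg (show ¬(0 < x ∧ x < 1) from hx),
      ENNReal.ofReal_zero]

/-- The endpoints are Lebesgue-null, and on the open interval both `x` and `1 - x` are positive. -/
lemma betaLevyMeasure_eq (α : ℝ) :
    betaLevyMeasure α = (volume.restrict (Ioo 0 1)).withDensity
      fun x => ENNReal.ofReal (α * x⁻¹ * (1 - x) ^ (α - 1)) := by
  rw [betaLevyMeasure, Measure.restrict_congr_set Ioo_ae_eq_Icc.symm]

instance sFinite_betaLevyMeasure (α : ℝ) : SFinite (betaLevyMeasure α) := by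
  rw [betaLevyMeasure]; infer_instance

instance noAtoms_betaLevyMeasure (α : ℝ) : NullSingletonClass (betaLevyMeasure α) := by
  rw [betaLevyMeasure]; infer_instance

lemma isProbabilityMeasure_betaMeasure_one (hα : 0 < α) : IsProbabilityMeasure (betaMeasure 1 α) :=
  isProbabilityMeasureBeta one_pos hα

lemma lintegral_betaMeasure_one (hα : 0 < α) (f : ℝ → ℝ≥0∞) (hf : Measurable f) :
    ∫⁻ x, f x ∂(betaMeasure 1 α)
      = ∫⁻ x in Ioo 0 1, ENNReal.ofReal (α * (1 - x) ^ (α - 1)) * f x := by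
  rw [betaMeasure_one_eq hα, lintegral_withDensity_eq_lintegral_mul _ (by fun_prop) hf]
  rfl

lemma lintegral_betaLevyMeasure (α : ℝ) (f : ℝ → ℝ≥0∞) (hf : Measurable f) :
    ∫⁻ x, f x ∂(betaLevyMeasure α)
      = ∫⁻ x in Ioo 0 1, ENNReal.ofReal (α * x⁻¹ * (1 - x) ^ (α - 1)) * f x := by
  rw [betaLevyMeasure_eq, lintegral_withDensity_eq_lintegral_mul _ (by fun_prop) hf]
  rfl

/-- The law of `1 - V` for `V ∼ Beta(1, α)`. -/
noncomputable def stickRemainder (α : ℝ) : Measure ℝ := (betaMeasure 1 α).map fun v => 1 - v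

lemma isProbabilityMeasure_stickRemainder (hα : 0 < α) :
    IsProbabilityMeasure (stickRemainder α) :=
  have := isProbabilityMeasure_betaMeasure_one hα
  Measure.isProbabilityMeasure_map (by fun_prop)

lemma ae_mem_Ioo_betaMeasure_one (hα : 0 < α) : ∀ᵐ v ∂(betaMeasure 1 α), v ∈ Ioo (0 : ℝ) 1 := by
  rw [betaMeasure_one_eq hα]
  exact (withDensity_absolutelyContinuous _ _).ae_le (ae_restrict_mem measurableSet_Ioo)

/-- An antiderivative evaluation behind the fixed point equation of the Lévy measure. -/
lemma lintegral_Ioo_rpow_mul_rpow (hα : 0 < α) {x : ℝ} (hx : x ∈ Ioo (0 : ℝ) 1) :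
    ∫⁻ p in Ioo x 1, ENNReal.ofReal (α * ((1 - p) / p) ^ (α - 1) * (p ^ 2)⁻¹)
      = ENNReal.ofReal (((1 - x) / x) ^ α) := by
  obtain ⟨hx0, hx1⟩ := hx
  -- The antiderivative comes from `d((1 - p) / p) = -p⁻² dp`; it vanishes at `1`.
  set g : ℝ → ℝ := fun p => -((1 - p) / p) ^ α with hg
  set g' : ℝ → ℝ := fun p => α * ((1 - p) / p) ^ (α - 1) * (p ^ 2)⁻¹ with hg'
  have hpos : ∀ p ∈ Ioo x 1, 0 ≤ g' p := fun p hp => by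
    have h1 : 0 < p := hx0.trans hp.1
    have h2 : 0 ≤ 1 - p := by linarith [hp.2]
    positivity
  have hcont : ContinuousOn g (Icc x 1) := by
    refine ContinuousOn.neg (ContinuousOn.rpow_const ?_ fun _ _ => Or.inr hα.le)
    exact (continuousOn_const.sub continuousOn_id).div continuousOn_id
      fun p hp => (hx0.trans_le hp.1).ne'
  have hderiv : ∀ p ∈ Ioo x 1, HasDerivAt g (g' p) p := fun p hp => by
    have h1 : 0 < p := hx0.trans hp.1
    have h2 : 0 < 1 - p := by linarith [hp.2]
    have h3 : HasDerivAt (fun p : ℝ => (1 - p) / p) (-(p ^ 2)⁻¹) p := by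
      refine (((hasDerivAt_id' p).const_sub 1).fun_div (hasDerivAt_id' p) h1.ne').congr_deriv ?_
      field_simp
      ring
    refine (h3.rpow_const (p := α) (Or.inl (div_pos h2 h1).ne')).fun_neg.congr_deriv ?_
    simp only [hg']
    ring
  -- For `α < 1` the integrand is unbounded near `1`; integrability follows from its sign and the
  -- continuity of `g` up to the endpoint.
  have hint := intervalIntegral.integrableOn_deriv_of_nonneg hcont hderiv hpos
  have hftc := intervalIntegral.integral_eq_sub_of_hasDerivAt_of_le hx1.le hcont hderiv
    ((intervalIntegrable_iff_integrableOn_Ioc_of_le hx1.le).2 hint)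
  rw [intervalIntegral.integral_of_le hx1.le, integral_Ioc_eq_integral_Ioo] at hftc
  rw [← ofReal_integral_eq_lintegral_ofReal (hint.mono_set Ioo_subset_Ioc_self)
    ((ae_restrict_iff' measurableSet_Ioo).2 (Eventually.of_forall hpos)), hftc]
  simp [hg, Real.zero_rpow hα.ne']

/-- The Lévy measure `λ` satisfies `λ = Beta(1, α) + T λ`, where `T λ` is the multiplicative
convolution of the law of `1 - V`, `V ∼ Beta(1, α)`, with `λ`. -/
lemma betaLevyMeasure_eq_add (hα : 0 < α) :
    betaLevyMeasure α = betaMeasure 1 α + stickRemainder α ∗ₘ betaLevyMeasure α := by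
  have := isProbabilityMeasure_betaMeasure_one hα
  have := isProbabilityMeasure_stickRemainder hα
  refine Measure.ext_of_lintegral _ fun f hf => ?_
  have hswap : ∫⁻ z, f z ∂(stickRemainder α ∗ₘ betaLevyMeasure α)
      = ∫⁻ x in Ioo 0 1, ENNReal.ofReal (α * (1 - x) ^ α * x⁻¹) * f x := by
    -- Substitute `x = p (1 - v)` for fixed `p`. The constraint `x < p` is kept as an indicator, so
    -- that both integrals run over `(0, 1)` and Tonelli applies.
    have hinner : ∀ p ∈ Ioo (0 : ℝ) 1,
        ENNReal.ofReal (α * p⁻¹ * (1 - p) ^ (α - 1)) * ∫⁻ u, f (p * u) ∂(stickRemainder α)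
        = ∫⁻ x in Ioo 0 1, (Ioi x).indicator (fun q => ENNReal.ofReal
            (α * ((1 - q) / q) ^ (α - 1) * (q ^ 2)⁻¹)) p
              * (ENNReal.ofReal (α * x ^ (α - 1)) * f x) := by
      intro p hp
      have hp0 := hp.1
      have hp1 : 0 < 1 - p := by linarith [hp.2]
      have himage : (fun v : ℝ => p * (1 - v)) '' Ioo 0 1 = Ioo 0 p := by
        ext x
        constructor
        · rintro ⟨v, hv, rfl⟩
          exact ⟨mul_pos hp0 (by linarith [hv.2]), by nlinarith [mul_pos hp0 hv.1]⟩
        · intro hx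
          refine ⟨1 - x / p, ⟨?_, ?_⟩, by field_simp; ring⟩
          · have := (div_lt_one hp0).2 hx.2
            linarith
          · have := div_pos hx.1 hp0
            linarith
      have hcv := lintegral_image_eq_lintegral_abs_deriv_mul (s := Ioo (0 : ℝ) 1)
        (f := fun v : ℝ => p * (1 - v)) (f' := fun _ => -p) measurableSet_Ioo
        (fun v _ => by
          simpa using (((hasDerivAt_id v).const_sub 1).const_mul p).hasDerivWithinAt)
        (fun v _ w _ hvw => by
          have := mul_left_cancel₀ hp0.ne' hvw
          linarith)
        (fun x => ENNReal.ofReal (α * ((1 - p) / p) ^ (α - 1) * (p ^ 2)⁻¹) *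
          (ENNReal.ofReal (α * x ^ (α - 1)) * f x))
      have hind : ∀ x : ℝ, (Ioi x).indicator (fun q => ENNReal.ofReal
            (α * ((1 - q) / q) ^ (α - 1) * (q ^ 2)⁻¹)) p
              * (ENNReal.ofReal (α * x ^ (α - 1)) * f x)
          = (Iio p).indicator (fun x => ENNReal.ofReal (α * ((1 - p) / p) ^ (α - 1) * (p ^ 2)⁻¹) *
          (ENNReal.ofReal (α * x ^ (α - 1)) * f x)) x := by
        intro x
        by_cases h : x < p <;> simp [h]
      simp_rw [hind]
      rw [setLIntegral_indicator measurableSet_Iio, Iio_inter_Ioo, min_eq_left hp.2.le, ← himage,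
        hcv, stickRemainder, lintegral_map (by fun_prop) (by fun_prop),
        lintegral_betaMeasure_one hα _ (by fun_prop), ← lintegral_const_mul _ (by fun_prop)]
      refine setLIntegral_congr_fun measurableSet_Ioo fun v hv => ?_
      have hv1 : 0 < 1 - v := by linarith [hv.2]
      rw [← mul_assoc, ← mul_assoc, ← mul_assoc, ← ENNReal.ofReal_mul (by positivity),
        ← ENNReal.ofReal_mul (by positivity), ← ENNReal.ofReal_mul (by positivity), abs_neg,
        abs_of_pos hp0]
      congr 2
      rw [Real.mul_rpow hp0.le hv1.le, Real.div_rpow hp1.le hp0.le]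
      have := (Real.rpow_pos_of_pos hp0 (α - 1)).ne'
      field_simp
    rw [Measure.mconv_comm, Measure.lintegral_mconv hf, lintegral_betaLevyMeasure _ _ (by fun_prop),
      setLIntegral_congr_fun measurableSet_Ioo hinner, lintegral_lintegral_swap]
    · refine setLIntegral_congr_fun measurableSet_Ioo fun x hx => ?_
      have h0 := hx.1
      have h1 : 0 < 1 - x := by linarith [hx.2]
      have hmeas : Measurable ((Ioi x).indicator fun q => ENNReal.ofReal
          (α * ((1 - q) / q) ^ (α - 1) * (q ^ 2)⁻¹)) :=
        Measurable.indicator (by fun_prop) measurableSet_Ioi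
      rw [lintegral_mul_const _ hmeas, setLIntegral_indicator measurableSet_Ioi, Ioi_inter_Ioo,
        max_eq_left h0.le, lintegral_Ioo_rpow_mul_rpow hα hx, ← mul_assoc,
        ← ENNReal.ofReal_mul (by positivity)]
      congr 2
      rw [Real.div_rpow h1.le h0.le, Real.rpow_sub_one h0.ne']
      have := (Real.rpow_pos_of_pos h0 α).ne'
      field_simp
    · have hset : MeasurableSet {q : ℝ × ℝ | q.2 < q.1} :=
        measurableSet_lt measurable_snd measurable_fst
      have hmeas : Measurable fun q : ℝ × ℝ => {q : ℝ × ℝ | q.2 < q.1}.indicator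
          (fun q => ENNReal.ofReal (α * ((1 - q.1) / q.1) ^ (α - 1) * (q.1 ^ 2)⁻¹)) q
            * (ENNReal.ofReal (α * q.2 ^ (α - 1)) * f q.2) :=
        Measurable.mul (Measurable.indicator (by fun_prop) hset) (by fun_prop)
      exact hmeas.aemeasurable
  rw [lintegral_add_measure, hswap, lintegral_betaMeasure_one hα _ hf,
    lintegral_betaLevyMeasure _ _ hf,
    ← lintegral_add_left (by fun_prop)]
  refine setLIntegral_congr_fun measurableSet_Ioo fun x hx => ?_
  have h1 : 0 < 1 - x := by linarith [hx.2]
  have h0 := hx.1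
  rw [← add_mul, ← ENNReal.ofReal_add (by positivity) (by positivity)]
  congr 2
  -- With the common factor `α (1 - x)^(α - 1) / x` removed, this is `x + (1 - x) = 1`.
  rw [Real.rpow_sub_one h1.ne']
  field_simp
  ring

/-- The law of the weight of an atom of round `i`. -/
noncomputable def stickWeightLaw (α : ℝ) : ℕ → Measure ℝ
  | 0 => betaMeasure 1 α
  | i + 1 => stickRemainder α ∗ₘ stickWeightLaw α i

/-- The iterates of multiplicative convolution by the law of `1 - V` on the Lévy measure. -/
noncomputable def levyTail (α : ℝ) : ℕ → Measure ℝ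
  | 0 => betaLevyMeasure α
  | n + 1 => stickRemainder α ∗ₘ levyTail α n

lemma isProbabilityMeasure_stickWeightLaw (hα : 0 < α) (i : ℕ) :
    IsProbabilityMeasure (stickWeightLaw α i) := by
  induction i with
  | zero => exact isProbabilityMeasure_betaMeasure_one hα
  | succ i ih =>
    have := isProbabilityMeasure_stickRemainder hα
    rw [stickWeightLaw]
    infer_instance

lemma sFinite_levyTail (hα : 0 < α) (n : ℕ) : SFinite (levyTail α n) := by
  induction n with
  | zero => exact sFinite_betaLevyMeasure α
  | succ n ih =>
    have := isProbabilityMeasure_stickRemainder hα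
    rw [levyTail]
    infer_instance

/-- Convolution is additive, so it can be applied `n` times to the fixed point equation. -/
lemma levyTail_eq_add (hα : 0 < α) (n : ℕ) :
    levyTail α n = stickWeightLaw α n + levyTail α (n + 1) := by
  induction n with
  | zero => exact betaLevyMeasure_eq_add hα
  | succ n ih =>
    have := isProbabilityMeasure_stickRemainder hα
    have := isProbabilityMeasure_stickWeightLaw hα n
    have := sFinite_levyTail hα (n + 1)
    conv_lhs => rw [levyTail, ih, Measure.mconv_add]
    rfl

lemma betaLevyMeasure_eq_sum_add (hα : 0 < α) (n : ℕ) :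
    betaLevyMeasure α = ∑ i ∈ Finset.range n, stickWeightLaw α i + levyTail α n := by
  induction n with
  | zero => simp [levyTail]
  | succ n ih => rw [Finset.sum_range_succ, add_assoc, ← levyTail_eq_add hα, ← ih]

/-- Only strictness is needed for geometric decay, and it follows from `1 - V < 1` almost surely. -/
lemma lintegral_stickRemainder_lt_one (hα : 0 < α) :
    ∫⁻ u, ENNReal.ofReal u ∂(stickRemainder α) < 1 := by
  have := isProbabilityMeasure_betaMeasure_one hα
  rw [stickRemainder, lintegral_map (by fun_prop) (by fun_prop)]
  have hlt : ∀ᵐ v ∂(betaMeasure 1 α), ENNReal.ofReal (1 - v) < 1 := by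
    filter_upwards [ae_mem_Ioo_betaMeasure_one hα] with v hv
    rw [← ENNReal.ofReal_one]
    exact ENNReal.ofReal_lt_ofReal_iff_of_nonneg (by linarith [hv.2]) |>.2 (by linarith [hv.1])
  have hle : ∫⁻ v, ENNReal.ofReal (1 - v) ∂(betaMeasure 1 α) ≤ 1 := by
    simpa using lintegral_mono_ae (hlt.mono fun _ h => h.le)
  simpa using lintegral_strict_mono (IsProbabilityMeasure.ne_zero (betaMeasure 1 α))
    aemeasurable_const (hle.trans_lt ENNReal.one_lt_top).ne hlt

/-- First moments multiply under multiplicative convolution. At `n = 0` the value is `1`, because `x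
λ(dx)` is the Beta(1, `α`) law. -/
lemma lintegral_levyTail (hα : 0 < α) (n : ℕ) :
    ∫⁻ x, ENNReal.ofReal x ∂(levyTail α n)
      = (∫⁻ u, ENNReal.ofReal u ∂(stickRemainder α)) ^ n := by
  induction n with
  | zero =>
    have := isProbabilityMeasure_betaMeasure_one hα
    rw [levyTail, lintegral_betaLevyMeasure _ _ (by fun_prop), pow_zero]
    have h1 : ∫⁻ _, 1 ∂(betaMeasure 1 α) = 1 := by simp
    rw [← h1, lintegral_betaMeasure_one hα _ (by fun_prop)]
    refine setLIntegral_congr_fun measurableSet_Ioo fun x hx => ?_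
    have h0 := hx.1
    have h1 : 0 < 1 - x := by linarith [hx.2]
    rw [mul_one, ← ENNReal.ofReal_mul (by positivity)]
    congr 1
    field_simp
  | succ n ih =>
    have := isProbabilityMeasure_stickRemainder hα
    have := sFinite_levyTail hα n
    have hnn : ∀ᵐ u ∂(stickRemainder α), 0 ≤ u := by
      rw [stickRemainder, ae_map_iff (by fun_prop) measurableSet_Ici]
      filter_upwards [ae_mem_Ioo_betaMeasure_one hα] with v hv
      linarith [hv.2]
    rw [levyTail, Measure.lintegral_mconv (by fun_prop), pow_succ', ← ih,
      ← lintegral_mul_const _ (by fun_prop)]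
    refine lintegral_congr_ae (hnn.mono fun u hu => ?_)
    simp only
    rw [← lintegral_const_mul _ (by fun_prop)]
    simp_rw [ENNReal.ofReal_mul hu]

/-- The Lévy measure of the beta process is the sum of the laws of the stick-breaking weights. -/
lemma betaLevyMeasure_eq_sum (hα : 0 < α) :
    betaLevyMeasure α = Measure.sum (stickWeightLaw α) := by
  -- `λ` has infinite mass near `0`, where the remainder need not become small; hence the comparison
  -- is made on sets that avoid `(0, ε)`.
  have hunion : ⋃ k : ℕ, (Iic (0 : ℝ) ∪ Ici (1 / ((k : ℝ) + 1))) = univ := by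
    refine eq_univ_of_forall fun x => ?_
    rw [mem_iUnion]
    rcases le_or_gt x 0 with hx | hx
    · exact ⟨0, Or.inl hx⟩
    · obtain ⟨k, hk⟩ := exists_nat_one_div_lt hx
      exact ⟨k, Or.inr hk.le⟩
  refine (Measure.ext_iff_of_iUnion_eq_univ hunion).2 fun k => ?_
  refine Measure.ext fun A hA => ?_
  rw [Measure.restrict_apply hA, Measure.restrict_apply hA]
  set ε : ℝ := 1 / ((k : ℝ) + 1) with hε
  have hε0 : 0 < ε := by positivity
  set B := A ∩ (Iic (0 : ℝ) ∪ Ici ε)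
  have hB : MeasurableSet B := hA.inter (measurableSet_Iic.union measurableSet_Ici)
  have htail : Tendsto (fun n => levyTail α n B) atTop (nhds 0) := by
    have hle : ∀ n, levyTail α n B
        ≤ (∫⁻ u, ENNReal.ofReal u ∂(stickRemainder α)) ^ n / ENNReal.ofReal ε := by
      intro n
      -- The remainder is a summand of `λ`, which does not charge `(-∞, 0]`.
      have h0 : levyTail α n (Iic 0) = 0 := by
        have h1 : betaLevyMeasure α (Iic 0) = 0 := by
          rw [betaLevyMeasure_eq]
          refine withDensity_absolutelyContinuous _ _ ?_
          rw [Measure.restrict_apply measurableSet_Iic]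
          have : Iic (0 : ℝ) ∩ Ioo 0 1 = ∅ := by
            ext x; simp; intro h h'; linarith
          simp [this]
        rw [betaLevyMeasure_eq_sum_add hα n] at h1
        exact (add_eq_zero.1 ((Measure.add_apply _ _ _).symm.trans h1)).2
      have h2 : levyTail α n (Ici ε)
          ≤ (∫⁻ u, ENNReal.ofReal u ∂(stickRemainder α)) ^ n / ENNReal.ofReal ε := by
        rw [← lintegral_levyTail hα n]
        refine (measure_mono fun x hx => ?_).trans (meas_ge_le_lintegral_div (by fun_prop)
          (by simpa using hε0) ENNReal.ofReal_ne_top)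
        exact ENNReal.ofReal_le_ofReal hx
      refine (measure_mono inter_subset_right).trans ((measure_union_le _ _).trans ?_)
      rwa [h0, zero_add]
    refine tendsto_of_tendsto_of_tendsto_of_le_of_le tendsto_const_nhds ?_
      (fun _ => zero_le) hle
    have := ENNReal.Tendsto.div_const (ENNReal.tendsto_pow_atTop_nhds_zero_of_lt_one
      (lintegral_stickRemainder_lt_one hα)) (b := ENNReal.ofReal ε) (Or.inr (by simpa using hε0))
    simpa using this
  rw [Measure.sum_apply _ hB]
  have hlim := (ENNReal.tendsto_nat_tsum fun i => stickWeightLaw α i B).add htail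
  rw [add_zero] at hlim
  refine tendsto_nhds_unique (tendsto_const_nhds.congr fun n => ?_) hlim
  conv_lhs => rw [betaLevyMeasure_eq_sum_add hα n]
  simp

/-- Each weight law is dominated by `λ`, which has a density. -/
lemma noAtoms_stickWeightLaw (hα : 0 < α) (i : ℕ) : NullSingletonClass (stickWeightLaw α i) := by
  refine ⟨fun x => le_antisymm ?_ zero_le⟩
  rw [← measure_singleton (μ := betaLevyMeasure α) x, betaLevyMeasure_eq_sum hα]
  exact Measure.le_sum _ i _

end BetaLevy

/-! ### Counting and summing over sets of distinct points -/

section Deterministic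

variable {E : Type*}

/-- If the supremum were a finite `m` below the left side, some `m + 1` points of the union would
already lie in a single `s n`. -/
lemma encard_iUnion_of_monotone {s : ℕ → Set E} (hs : Monotone s) :
    (⋃ n, s n).encard = ⨆ n, (s n).encard := by
  refine le_antisymm ?_ (iSup_le fun n => Set.encard_le_encard (Set.subset_iUnion s n))
  by_contra! hlt
  obtain ⟨m, hm⟩ := ENat.ne_top_iff_exists.1 (ne_top_of_lt hlt)
  rw [← hm] at hlt
  obtain ⟨t, hts, htc⟩ := Set.exists_subset_encard_eq (Order.add_one_le_of_lt hlt)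
  have htf : t.Finite := Set.finite_of_encard_eq_coe (k := m + 1) (by simpa using htc)
  obtain ⟨n, hn⟩ := Directed.exists_mem_subset_of_finset_subset_biUnion hs.directed_le
    (s := htf.toFinset) (by simpa using hts)
  rw [htf.coe_toFinset] at hn
  have h1 : t.encard ≤ m := hm ▸ (Set.encard_le_encard hn).trans (le_iSup (fun n => (s n).encard) n)
  rw [htc] at h1
  exact absurd h1 (by exact_mod_cast Nat.not_succ_le_self m)

/-- The number of points in `A` of a sequence of finite sequences of distinct points. -/
lemma encard_points_inter {c : ℕ → ℕ} {x : ℕ → ℕ → E}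
    (hx : Function.Injective fun q : ℕ × ℕ => x q.1 q.2) (A : Set E) :
    ({p | ∃ i j : ℕ, j < c i ∧ p = x i j} ∩ A).encard
      = ⨆ n, ((∑ i ∈ Finset.range n, markCount A (c i) (x i) : ℕ) : ℕ∞) := by
  classical
  -- `F n` indexes the points in `A` from the first `n` rounds; injectivity makes its cardinality
  -- that of the set of points.
  set F : ℕ → Finset (ℕ × ℕ) := fun n => (Finset.range n).biUnion fun i =>
    ((Finset.range (c i)).filter fun j => x i j ∈ A).map ⟨Prod.mk i, Prod.mk_right_injective i⟩
    with hF
  have hmem : ∀ n q, q ∈ F n ↔ q.1 < n ∧ q.2 < c q.1 ∧ x q.1 q.2 ∈ A := by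
    rintro n ⟨i, j⟩
    simp only [hF, Finset.mem_biUnion, Finset.mem_range, Finset.mem_map, Finset.mem_filter,
      Function.Embedding.coeFn_mk, Prod.mk.injEq]
    constructor
    · rintro ⟨a, ha, b, hb, rfl, rfl⟩
      exact ⟨ha, hb⟩
    · rintro ⟨ha, hb⟩
      exact ⟨i, ha, j, hb, rfl, rfl⟩
  have hcard : ∀ n, (F n).card = ∑ i ∈ Finset.range n, markCount A (c i) (x i) := by
    intro n
    rw [hF, Finset.card_biUnion]
    · refine Finset.sum_congr rfl fun i _ => ?_
      rw [Finset.card_map, Finset.card_filter, markCount]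
      refine Finset.sum_congr rfl fun j _ => ?_
      simp [Set.indicator_apply]
    · intro i _ j _ hij
      rw [Function.onFun, Finset.disjoint_left]
      simp only [Finset.mem_map, Finset.mem_filter, Function.Embedding.coeFn_mk]
      rintro _ ⟨a, _, rfl⟩ ⟨b, _, hb⟩
      exact hij (congrArg Prod.fst hb).symm
  have hunion : {p | ∃ i j : ℕ, j < c i ∧ p = x i j} ∩ A
      = ⋃ n, (fun q : ℕ × ℕ => x q.1 q.2) '' (F n : Set (ℕ × ℕ)) := by
    ext p
    simp only [Set.mem_inter_iff, Set.mem_ofPred_eq, Set.mem_iUnion, Set.mem_image,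
      Finset.mem_coe, hmem]
    constructor
    · rintro ⟨⟨i, j, hj, rfl⟩, hA⟩
      exact ⟨i + 1, (i, j), ⟨Nat.lt_succ_self i, hj, hA⟩, rfl⟩
    · rintro ⟨n, ⟨i, j⟩, ⟨_, hj, hA⟩, rfl⟩
      exact ⟨⟨i, j, hj, rfl⟩, hA⟩
  have hmono : Monotone fun n => (fun q : ℕ × ℕ => x q.1 q.2) '' (F n : Set (ℕ × ℕ)) :=
    fun a b hab => Set.image_mono fun q hq => by
      rw [Finset.mem_coe, hmem] at hq ⊢
      exact ⟨hq.1.trans_le hab, hq.2⟩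
  rw [hunion, encard_iUnion_of_monotone hmono]
  simp_rw [hx.encard_image, Set.encard_coe_eq_coe_finsetCard, hcard]

/-- The weighted atoms of a sequence of finite sequences of distinct points. -/
lemma weightedAtoms_points {Θ : Type*} [MeasurableSpace Θ] {c : ℕ → ℕ} {x : ℕ → ℕ → Θ × ℝ}
    (hx : Function.Injective fun q : ℕ × ℕ => x q.1 q.2) :
    weightedAtoms {p | ∃ i j : ℕ, j < c i ∧ p = x i j}
      = Measure.sum fun i => ∑ j ∈ Finset.range (c i),
          ENNReal.ofReal (x i j).2 • Measure.dirac (x i j).1 := by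
  refine Measure.ext fun A hA => ?_
  rw [weightedAtoms, Measure.sum_apply _ hA, Measure.sum_apply _ hA]
  set f : Θ × ℝ → ℝ≥0∞ := fun p => (ENNReal.ofReal p.2 • Measure.dirac p.1) A with hf
  have himage : {p | ∃ i j : ℕ, j < c i ∧ p = x i j}
      = (fun q : ℕ × ℕ => x q.1 q.2) '' {q | q.2 < c q.1} := by
    ext p
    constructor
    · rintro ⟨i, j, hj, rfl⟩
      exact ⟨(i, j), hj, rfl⟩
    · rintro ⟨⟨i, j⟩, hj, rfl⟩
      exact ⟨i, j, hj, rfl⟩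
  calc ∑' p : {p | ∃ i j : ℕ, j < c i ∧ p = x i j}, f p
      = ∑' q : {q : ℕ × ℕ | q.2 < c q.1}, f (x q.1.1 q.1.2) := by
        rw [himage, tsum_image f hx.injOn]
    _ = ∑' i, ∑ j ∈ Finset.range (c i), f (x i j) := by
        rw [tsum_subtype {q : ℕ × ℕ | q.2 < c q.1} fun q => f (x q.1 q.2), ENNReal.tsum_prod']
        refine tsum_congr fun i => ?_
        rw [tsum_eq_sum (s := Finset.range (c i))]
        · refine Finset.sum_congr rfl fun j hj => ?_
          exact Set.indicator_of_mem (show (i, j) ∈ {q : ℕ × ℕ | q.2 < c q.1} from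
            Finset.mem_range.1 hj) _
        · intro j hj
          exact Set.indicator_of_notMem (show (i, j) ∉ {q : ℕ × ℕ | q.2 < c q.1} from
            fun h => hj (Finset.mem_range.2 h)) _
    _ = _ := by simp [hf]

end Deterministic

/-! ### The stick-breaking points and their Poisson counts -/

section Stick

lemma indepFun_of_measurable_iSup {S ι β γ : Type*} {mS : MeasurableSpace S} {P : Measure S}
    {m : ι → MeasurableSpace S} (hm : ∀ i, m i ≤ mS) (h : iIndep m P)
    {T U : Set ι} (hTU : Disjoint T U) [MeasurableSpace β] [MeasurableSpace γ]
    {X : S → β} {Y : S → γ} (hX : Measurable[⨆ i ∈ T, m i] X) (hY : Measurable[⨆ i ∈ U, m i] Y) :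
    IndepFun X Y P := by
  rw [IndepFun_iff_Indep]
  exact indep_of_indep_of_le_left (indep_of_indep_of_le_right (indep_iSup_of_disjoint hm h hTU)
    hY.comap_le) hX.comap_le

variable {S Θ : Type*} {mS : MeasurableSpace S} [MeasurableSpace Θ] {P : Measure S}
  {α : ℝ} {μ : Measure Θ}

/-- Peel off the first break: `1 - W 0` is independent of the remaining product, which is a weight
of the previous round built from the shifted breaks. This matches the recursion for
`stickWeightLaw`. -/
lemma hasLaw_stickWeightLaw [IsProbabilityMeasure P] (hα : 0 < α) {i : ℕ} {W : Fin (i + 1) → S → ℝ}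
    (hm : ∀ l, Measurable (W l)) (hl : ∀ l, HasLaw (W l) (betaMeasure 1 α) P)
    (hi : iIndepFun W P) :
    HasLaw (fun s => W (Fin.last i) s * ∏ l : Fin i, (1 - W l.castSucc s))
      (stickWeightLaw α i) P := by
  induction i with
  | zero => simpa [stickWeightLaw] using hl 0
  | succ i ih =>
    have := isProbabilityMeasure_betaMeasure_one hα
    have := isProbabilityMeasure_stickRemainder hα
    have := isProbabilityMeasure_stickWeightLaw hα i
    have htail := ih (W := fun l => W l.succ) (fun l => hm _) (fun l => hl _)
      (hi.precomp (Fin.succ_injective _))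
    have hrem : HasLaw (fun s => 1 - W 0 s) (stickRemainder α) P := by
      refine HasLaw.fun_comp (Y := fun v => 1 - v) ?_ (hl 0)
      exact ⟨by fun_prop, rfl⟩
    have hle : ∀ l : Fin (i + 1), Measurable[⨆ k ∈ Set.range (Fin.succ : Fin (i + 1) → Fin (i + 2)),
        MeasurableSpace.comap (W k) inferInstance] (W l.succ) := fun l =>
      (comap_measurable (W l.succ)).mono
        (le_iSup₂ (f := fun k _ => MeasurableSpace.comap (W k) inferInstance) l.succ ⟨l, rfl⟩) le_rfl
    have hind : IndepFun (fun s => 1 - W 0 s)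
        (fun s => W (Fin.last i).succ s * ∏ l : Fin i, (1 - W l.castSucc.succ s)) P := by
      refine indepFun_of_measurable_iSup (fun l => (hm l).comap_le)
        ((iIndepFun_iff_iIndep _ _ _).1 hi) (T := {0}) (U := Set.range Fin.succ) ?_ ?_ ?_
      · rw [Set.disjoint_singleton_left]
        rintro ⟨l, hl⟩
        exact Fin.succ_ne_zero l hl
      · refine measurable_const.sub ((comap_measurable (W 0)).mono ?_ le_rfl)
        exact le_iSup₂ (f := fun k _ => MeasurableSpace.comap (W k) inferInstance) 0 rfl
      · exact (hle _).mul (Finset.measurable_prod _ fun l _ => measurable_const.sub (hle _))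
    have := hind.hasLaw_fun_mul hrem htail
    refine this.congr (Filter.Eventually.of_forall fun s => ?_)
    simp only
    rw [Fin.prod_univ_succ]
    simp only [Fin.castSucc_zero, Fin.succ_last, Fin.succ_castSucc]
    ring

variable {C : ℕ → S → ℕ} {V : (i j : ℕ) → Fin (i + 1) → S → ℝ} {θ : ℕ → ℕ → S → Θ}

/-- The `j`-th potential point of round `i`. -/
noncomputable def stickPoint (V : (i j : ℕ) → Fin (i + 1) → S → ℝ) (θ : ℕ → ℕ → S → Θ)
    (i j : ℕ) (s : S) : Θ × ℝ :=
  (θ i j s, stickWeight V i j s)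

lemma IsStickBreakingFamily.stickSigma_le (h : IsStickBreakingFamily α μ P C V θ)
    (k : StickIndex) : stickSigma C V θ k ≤ mS := by
  cases k with
  | count i => exact (h.measurable_count i).comap_le
  | stick i j l => exact (h.measurable_stick i j l).comap_le
  | location i j => exact (h.measurable_location i j).comap_le

lemma measurable_stickWeight_of_forall {m : MeasurableSpace S} {i j : ℕ}
    (hV : ∀ l, Measurable (V i j l)) : Measurable (stickWeight V i j) :=
  (hV _).mul (Finset.measurable_prod _ fun _ _ => measurable_const.sub (hV _))

lemma measurable_count_iSup {T : Set StickIndex} {i : ℕ} (hi : .count i ∈ T) :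
    Measurable[⨆ k ∈ T, stickSigma C V θ k] (C i) :=
  (comap_measurable (C i)).mono (le_iSup₂ (f := fun k _ => stickSigma C V θ k) _ hi) le_rfl

lemma measurable_location_iSup {T : Set StickIndex} {i j : ℕ} (hi : .location i j ∈ T) :
    Measurable[⨆ k ∈ T, stickSigma C V θ k] (θ i j) :=
  (comap_measurable (θ i j)).mono (le_iSup₂ (f := fun k _ => stickSigma C V θ k) _ hi) le_rfl

lemma measurable_stickWeight_iSup {T : Set StickIndex} {i j : ℕ} (hi : ∀ l, .stick i j l ∈ T) :
    Measurable[⨆ k ∈ T, stickSigma C V θ k] (stickWeight V i j) :=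
  measurable_stickWeight_of_forall fun l => (comap_measurable (V i j l)).mono
    (le_iSup₂ (f := fun k _ => stickSigma C V θ k) _ (hi l)) le_rfl

lemma measurable_stickPoint_iSup {T : Set StickIndex} {i j : ℕ} (hi : .location i j ∈ T)
    (hi' : ∀ l, .stick i j l ∈ T) :
    Measurable[⨆ k ∈ T, stickSigma C V θ k] (stickPoint V θ i j) :=
  (measurable_location_iSup hi).prodMk (measurable_stickWeight_iSup hi')

namespace IsStickBreakingFamily

lemma measurable_stickWeight (h : IsStickBreakingFamily α μ P C V θ) (i j : ℕ) :
    Measurable (stickWeight V i j) :=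
  measurable_stickWeight_of_forall (h.measurable_stick i j)

lemma measurable_stickPoint (h : IsStickBreakingFamily α μ P C V θ) (i j : ℕ) :
    Measurable (stickPoint V θ i j) :=
  (h.measurable_location i j).prodMk (h.measurable_stickWeight i j)

lemma hasLaw_stickWeight [IsProbabilityMeasure P]
    (h : IsStickBreakingFamily α μ P C V θ) (hα : 0 < α) (i j : ℕ) :
    HasLaw (stickWeight V i j) (stickWeightLaw α i) P := by
  refine hasLaw_stickWeightLaw hα (h.measurable_stick i j) (h.law_stick i j) ?_
  rw [iIndepFun_iff_iIndep]
  exact h.indep.precomp (g := StickIndex.stick i j) fun l l' hl => by simpa using hl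

lemma hasLaw_stickPoint [IsProbabilityMeasure P]
    (h : IsStickBreakingFamily α μ P C V θ) (hα : 0 < α) (i j : ℕ) :
    HasLaw (stickPoint V θ i j) (((μ Set.univ)⁻¹ • μ).prod (stickWeightLaw α i)) P := by
  refine (indepFun_iff_hasLaw_prodMk_prod (h.law_location i j) (h.hasLaw_stickWeight hα i j)).1 ?_
  refine indepFun_of_measurable_iSup h.stickSigma_le h.indep (T := {.location i j})
    (U := Set.range (StickIndex.stick i j)) ?_ (measurable_location_iSup rfl)
    (measurable_stickWeight_iSup fun l => ⟨l, rfl⟩)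
  rw [Set.disjoint_singleton_left]
  rintro ⟨l, hl⟩
  cases hl

lemma iIndepFun_stickPoint (h : IsStickBreakingFamily α μ P C V θ) (i : ℕ) :
    iIndepFun (stickPoint V θ i) P := by
  refine iIndepFun_of_measurable_iSup h.stickSigma_le h.indep
    (T := fun j => {k | k = .location i j ∨ ∃ l, k = .stick i j l}) ?_
    fun j => measurable_stickPoint_iSup (Or.inl rfl) fun l => Or.inr ⟨l, rfl⟩
  intro j j' hj
  rw [Set.disjoint_left]
  rintro k (rfl | ⟨l, rfl⟩) (h' | ⟨l', h'⟩) <;> cases h' <;> exact hj rfl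

lemma indepFun_count_stickPoint (h : IsStickBreakingFamily α μ P C V θ) (i : ℕ) :
    IndepFun (C i) (fun s j => stickPoint V θ i j s) P := by
  refine indepFun_of_measurable_iSup h.stickSigma_le h.indep (T := {.count i})
    (U := {.count i}ᶜ) disjoint_compl_right (measurable_count_iSup rfl) ?_
  exact @measurable_pi_iff _ _ _ (_) _ _ |>.2 fun j => measurable_stickPoint_iSup (by simp) (by simp)

/-- The counts in different rounds are independent. -/
lemma iIndepFun_markCount_round (h : IsStickBreakingFamily α μ P C V θ) {κ : Type*}
    {A : κ → Set (Θ × ℝ)} (hA : ∀ k, MeasurableSet (A k)) :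
    iIndepFun (fun i s k => markCount (A k) (C i s) fun j => stickPoint V θ i j s) P := by
  refine iIndepFun_of_measurable_iSup h.stickSigma_le h.indep
    (T := fun i => {k | k = .count i ∨ (∃ j, k = .location i j) ∨ ∃ j l, k = .stick i j l}) ?_ ?_
  · intro i i' hi
    rw [Set.disjoint_left]
    rintro k (rfl | ⟨j, rfl⟩ | ⟨j, l, rfl⟩) (h' | ⟨j', h'⟩ | ⟨j', l', h'⟩) <;> cases h' <;>
      exact hi rfl
  · intro i
    refine @measurable_pi_iff _ _ _ (_) _ _ |>.2 fun k => ?_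
    refine @measurable_markCount _ _ (_) _ _ (hA k) _ _ ?_ fun j => ?_
    · exact measurable_count_iSup (Or.inl rfl)
    · exact measurable_stickPoint_iSup (Or.inr (Or.inl ⟨j, rfl⟩))
        fun l => Or.inr (Or.inr ⟨j, l, rfl⟩)

/-- Almost surely, all potential points are distinct. -/
lemma ae_injective_stickPoint [IsProbabilityMeasure P]
    (h : IsStickBreakingFamily α μ P C V θ) (hα : 0 < α) :
    ∀ᵐ s ∂P, Function.Injective fun q : ℕ × ℕ => stickPoint V θ q.1 q.2 s := by
  -- Distinct weights already make the points distinct. Two weights are independent with atomless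
  -- laws, so the diagonal is null for their joint law.
  have hne : ∀ q q' : ℕ × ℕ, q ≠ q' →
      ∀ᵐ s ∂P, stickWeight V q.1 q.2 s ≠ stickWeight V q'.1 q'.2 s := by
    intro q q' hq
    have hind : IndepFun (stickWeight V q.1 q.2) (stickWeight V q'.1 q'.2) P := by
      refine indepFun_of_measurable_iSup h.stickSigma_le h.indep
        (T := {k | ∃ l, k = .stick q.1 q.2 l}) (U := {k | ∃ l, k = .stick q'.1 q'.2 l}) ?_
        (measurable_stickWeight_iSup fun l => ⟨l, rfl⟩)
        (measurable_stickWeight_iSup fun l => ⟨l, rfl⟩)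
      rw [Set.disjoint_left]
      rintro k ⟨l, rfl⟩ ⟨l', h'⟩
      rw [StickIndex.stick.injEq] at h'
      exact hq (Prod.ext h'.1 h'.2.1)
    have := isProbabilityMeasure_stickWeightLaw hα q.1
    have := isProbabilityMeasure_stickWeightLaw hα q'.1
    have := noAtoms_stickWeightLaw hα q'.1
    have hlaw := (indepFun_iff_hasLaw_prodMk_prod (h.hasLaw_stickWeight hα q.1 q.2)
      (h.hasLaw_stickWeight hα q'.1 q'.2)).1 hind
    refine (hlaw.ae_iff (p := fun z => z.1 ≠ z.2) ?_).2 ?_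
    · exact (measurableSet_eq_fun measurable_fst measurable_snd).compl.mem
    · rw [ae_iff]
      simp only [ne_eq, not_not]
      rw [Measure.measure_prod_null (measurableSet_eq_fun measurable_fst measurable_snd)]
      refine Filter.Eventually.of_forall fun x => ?_
      have : Prod.mk x ⁻¹' {z : ℝ × ℝ | z.1 = z.2} = {x} := by
        ext y; simp [eq_comm]
      exact (congrArg _ this).trans (measure_singleton x)
  have hall : ∀ᵐ s ∂P, ∀ q q' : ℕ × ℕ, q ≠ q' →
      stickWeight V q.1 q.2 s ≠ stickWeight V q'.1 q'.2 s := by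
    simp_rw [ae_all_iff]
    exact hne
  filter_upwards [hall] with s hs q q' hqq'
  by_contra hq
  exact hs q q' hq (congrArg Prod.snd hqq')

lemma ae_stickWeight_mem_Icc (h : IsStickBreakingFamily α μ P C V θ) (hα : 0 < α) :
    ∀ᵐ s ∂P, ∀ i j, stickWeight V i j s ∈ Set.Icc (0 : ℝ) 1 := by
  have hV : ∀ᵐ s ∂P, ∀ i j l, V i j l s ∈ Set.Ioo (0 : ℝ) 1 := by
    simp_rw [ae_all_iff]
    exact fun i j l => ((h.law_stick i j l).ae_iff measurableSet_Ioo.mem).2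
      (ae_mem_Ioo_betaMeasure_one hα)
  filter_upwards [hV] with s hs i j
  have h0 : 0 ≤ ∏ l : Fin i, (1 - V i j l.castSucc s) :=
    Finset.prod_nonneg fun l _ => by linarith [(hs i j l.castSucc).2]
  have h1 : ∏ l : Fin i, (1 - V i j l.castSucc s) ≤ 1 :=
    Finset.prod_le_one (fun l _ => by linarith [(hs i j l.castSucc).2])
      fun l _ => by linarith [(hs i j l.castSucc).1]
  exact ⟨mul_nonneg (hs i j _).1.le h0, mul_le_one₀ (hs i j _).2.le h0 h1⟩

lemma measurable_stickBreakingMeasure (h : IsStickBreakingFamily α μ P C V θ) :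
    Measurable (stickBreakingMeasure C V θ) := by
  refine Measure.measurable_of_measurable_coe _ fun A hA => ?_
  simp only [stickBreakingMeasure, Measure.sum_apply _ hA, Measure.finsetSum_apply,
    Measure.smul_apply, smul_eq_mul, Measure.dirac_apply' _ hA]
  refine Measurable.tsum fun i => ?_
  have hj : ∀ j, Measurable fun s =>
      ENNReal.ofReal (stickWeight V i j s) * A.indicator 1 (θ i j s) := fun j =>
    (h.measurable_stickWeight i j).ennreal_ofReal.mul
      ((measurable_one.indicator hA).comp (h.measurable_location i j))
  have hm : Measurable fun q : ℕ × S => ∑ j ∈ Finset.range q.1,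
      ENNReal.ofReal (stickWeight V i j q.2) * A.indicator 1 (θ i j q.2) :=
    measurable_from_prod_countable_right fun n =>
      Finset.measurable_sum (Finset.range n) fun j _ => hj j
  exact hm.comp ((h.measurable_count i).prodMk measurable_id)

/-- The Poisson mean `γ` cancels the normalisation of `μ / γ`, and the weight laws sum to `λ`. All
terms are finite, so `toNNReal` loses nothing. -/
lemma tsum_intensity [IsFiniteMeasure μ] (hμ : μ ≠ 0) (hα : 0 < α) {A : Set (Θ × ℝ)}
    (hA : MeasurableSet A) :
    ∑' i, (((μ Set.univ).toNNReal *
      ((((μ Set.univ)⁻¹ • μ).prod (stickWeightLaw α i)) A).toNNReal : ℝ≥0) : ℝ≥0∞)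
      = betaMeanMeasure α μ A := by
  have := isProbabilityMeasure_stickWeightLaw hα
  have hμ0 : μ Set.univ ≠ 0 := by simpa using hμ
  have hμt : μ Set.univ ≠ ∞ := measure_ne_top _ _
  rw [betaMeanMeasure, betaLevyMeasure_eq_sum hα, Measure.prod_sum_right, Measure.sum_apply _ hA]
  refine tsum_congr fun i => ?_
  rw [Measure.prod_smul_left, Measure.smul_apply, smul_eq_mul, ENNReal.coe_mul,
    ENNReal.coe_toNNReal hμt,
    ENNReal.coe_toNNReal (ENNReal.mul_ne_top (ENNReal.inv_ne_top.2 hμ0) (measure_ne_top _ _)),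
    ← mul_assoc, ENNReal.mul_inv_cancel hμ0 hμt, one_mul]

lemma isPoissonProcess_stickBreakingPoints [IsProbabilityMeasure P] [IsFiniteMeasure μ] (hμ : μ ≠ 0)
    (h : IsStickBreakingFamily α μ P C V θ) (hα : 0 < α) :
    IsPoissonProcess P (stickBreakingPoints C V θ) (betaMeanMeasure α μ) := by
  -- Almost sure distinctness turns the cardinality of a random set into the sum of the counts of
  -- the rounds.
  have hcount : ∀ A : Set (Θ × ℝ), (fun s => (stickBreakingPoints C V θ s ∩ A).encard) =ᵐ[P]
      fun s => ⨆ n, ((∑ i ∈ Finset.range n,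
        markCount A (C i s) fun j => stickPoint V θ i j s : ℕ) : ℕ∞) := by
    intro A
    filter_upwards [h.ae_injective_stickPoint hα] with s hs
    exact encard_points_inter (c := fun i => C i s) (x := fun i j => stickPoint V θ i j s) hs A
  have hm : ∀ {A : Set (Θ × ℝ)}, MeasurableSet A → ∀ i,
      Measurable fun s => markCount A (C i s) fun j => stickPoint V θ i j s := fun hA i =>
    measurable_markCount hA (h.measurable_count i) (h.measurable_stickPoint i)
  refine ⟨Filter.Eventually.of_forall fun s => ?_, fun A hA => ?_, fun n A hA hdisj => ?_⟩
  · refine (Set.countable_range fun q : ℕ × ℕ => stickPoint V θ q.1 q.2 s).mono ?_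
    rintro _ ⟨i, j, -, rfl⟩
    exact ⟨(i, j), rfl⟩
  · refine HasLaw.congr ?_ (hcount A)
    rw [← tsum_intensity hμ hα hA]
    refine hasLaw_iSup_sum_range_poisson (hm hA) (fun i => ?_) ?_
    · exact hasLaw_markCount (h.measurable_count i) (h.law_count i) (h.measurable_stickPoint i)
        (h.hasLaw_stickPoint hα i) (h.iIndepFun_stickPoint i) (h.indepFun_count_stickPoint i) hA
    · exact (h.iIndepFun_markCount_round (κ := Unit) (A := fun _ => A) fun _ => hA).comp
        (fun _ f => f ()) fun _ => measurable_pi_apply _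
  · refine (iIndepFun_congr fun k => hcount (A k)).2 ?_
    -- The array of counts is independent across rounds, and within a round by disjointness of the
    -- sets; hence all entries are independent. Each `N(A k)` depends only on column `k`.
    have hall : iIndepFun (fun (q : ℕ × Fin n) s =>
        markCount (A q.2) (C q.1 s) fun j => stickPoint V θ q.1 j s) P :=
      iIndepFun_uncurry' (X := fun i k s => markCount (A k) (C i s) fun j => stickPoint V θ i j s)
        (fun i k => hm (hA k) i) (h.iIndepFun_markCount_round hA) fun i =>
          iIndepFun_markCount (h.measurable_count i) (h.law_count i) (h.measurable_stickPoint i)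
            (h.hasLaw_stickPoint hα i) (h.iIndepFun_stickPoint i) (h.indepFun_count_stickPoint i)
            hA hdisj
    refine iIndepFun_of_measurable_iSup (fun q : ℕ × Fin n => (hm (hA q.2) q.1).comap_le)
      ((iIndepFun_iff_iIndep _ _ _).1 hall) (T := fun k => {q | q.2 = k}) ?_ fun k => ?_
    · intro k l hkl
      rw [Set.disjoint_left]
      rintro q rfl rfl
      exact hkl rfl
    · refine Measurable.iSup fun N => measurable_from_nat.comp
        (Finset.measurable_sum _ fun i _ => ?_)
      have hle := le_iSup₂ (f := fun (q : ℕ × Fin n) (_ : q ∈ {q : ℕ × Fin n | q.2 = k}) =>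
        MeasurableSpace.comap (fun s => markCount (A q.2) (C q.1 s) fun j => stickPoint V θ q.1 j s)
          inferInstance) (i, k) rfl
      exact (comap_measurable fun s => markCount (A k) (C i s) fun j => stickPoint V θ i j s).mono
        hle le_rfl

lemma hasUnderlyingBetaPoisson [IsProbabilityMeasure P] [IsFiniteMeasure μ] (hμ : μ ≠ 0)
    (h : IsStickBreakingFamily α μ P C V θ) (hα : 0 < α) :
    HasUnderlyingBetaPoisson α μ P (stickBreakingMeasure C V θ) (stickBreakingPoints C V θ) where
  weights_mem := by
    filter_upwards [h.ae_stickWeight_mem_Icc hα] with s hs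
    rintro _ ⟨i, j, -, rfl⟩
    exact hs i j
  poisson := h.isPoissonProcess_stickBreakingPoints hμ hα
  eq_weightedAtoms := by
    filter_upwards [h.ae_injective_stickPoint hα] with s hs
    exact (weightedAtoms_points (c := fun i => C i s) (x := fun i j => stickPoint V θ i j s) hs).symm

end IsStickBreakingFamily

end Stick

theorem theorem2 {S Θ : Type*} [MeasurableSpace S] [MeasurableSpace Θ]
    (P : Measure S) [IsProbabilityMeasure P]
    (α : ℝ) (hα : 0 < α)
    (μ : Measure Θ) [IsFiniteMeasure μ] [NullSingletonClass μ] (hμ : μ ≠ 0)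
    (C : ℕ → S → ℕ) (V : (i j : ℕ) → Fin (i + 1) → S → ℝ) (θ : ℕ → ℕ → S → Θ)
    (h : IsStickBreakingFamily α μ P C V θ) :
    IsBetaProcess α μ P (stickBreakingMeasure C V θ) ∧
      HasUnderlyingBetaPoisson α μ P (stickBreakingMeasure C V θ)
        (stickBreakingPoints C V θ) := by
  have hunder := h.hasUnderlyingBetaPoisson hμ hα
  exact ⟨⟨h.measurable_stickBreakingMeasure.aemeasurable, _, hunder⟩, hunder⟩
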